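/- For a positive integer $n$, let $\pi_n$ be a uniformly random permutation of $n$ letters, let $\mathrm{ord}(\pi_n)$ be its order in the symmetric group $S_n$, and let \[K_n = \{k \in \{0,1,\ldots,n-1\} : \mathrm{lcm}(1,2,\ldots,k) \mid n-k\}\] (the empty lcm, for $k = 0$, being $1$). For $k \in K_n$ define \[\eta(n,k) = \begin{cases} 0 & \text{if } k \in \{0,1\} \text{ or } 2^{\lfloor \log_2 k\rfloor + 1} \mid n-k,\\ \dfrac{2^{1-\lfloor \log_2 k\rfloor}}{(n-k)^2} & \text{otherwise.}\end{cases}\] Then, uniformly over all $n \geq 1$ and all $k \in K_n$, \[\mathbb{P}(\mathrm{ord}(\pi_n) = n-k) = \frac{1}{n-k} + \eta(n,k) + O(n^{-3+o(1)}).\] That is, there are a constant $C > 0$ and a function $\varepsilon \colon \mathbb{N} \to \mathbb{R}$ with $\varepsilon(n) \to 0$ as $n \to \infty$ such that for all $n \geq 1$ and all $k \in K_n$, \[\left|\mathbb{P}(\mathrm{ord}(\pi_n) = n-k) - \frac{1}{n-k} - \eta(n,k)\right| \leq C\, n^{-3+\varepsilon(n)}.\] -/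

import Mathlib

namespace ExactOrder

/-- The probability that a uniformly random permutation of `n` letters has order exactly `m`:
the number of such permutations divided by the number `n!` of all permutations. -/
noncomputable def orderProb (n m : ℕ) : ℝ :=
  (Nat.card {σ : Equiv.Perm (Fin n) // orderOf σ = m} : ℝ)
    / (Nat.card (Equiv.Perm (Fin n)) : ℝ)

/-- The set of all `k ∈ {0, 1, …, n - 1}` such that `lcm(1, 2, …, k)` divides `n - k`.
The natural-number subtraction is the true one since `k < n`. -/
def K (n : ℕ) : Finset ℕ :=
  (Finset.range n).filter (fun k => (Finset.Icc 1 k).lcm id ∣ n - k)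

/-- The correction term. For `k ≥ 1` the number `Nat.log 2 k` is `⌊log₂ k⌋`. -/
noncomputable def eta (n k : ℕ) : ℝ :=
  if (k = 0 ∨ k = 1) ∨ 2 ^ (Nat.log 2 k + 1) ∣ n - k then 0
  else (2 : ℝ) ^ (1 - (Nat.log 2 k : ℤ)) / ((n : ℝ) - (k : ℝ)) ^ 2

end ExactOrder

/-! Put `m = n - k` and let τ be the number of divisors of `m`. For `n ≥ 10` one has `m > 2k`, and
order `m` arises in three ways. (1) There is an `m`-cycle: the other cycles have lengths at most
`k`, all dividing `m`, so the order is automatically `m`; this has probability `1/m`. (2) There are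
two cycles of length `h = m/2`, and the other `k` points supply the missing factor 2. A 2-adic
argument shows that this needs a cycle of length `2^⌊log₂ k⌋` and is impossible if `2^(⌊log₂ k⌋+1) ∣
m`; the probability is `eta n k` (`cycleExp_halfPairTerm`). (3) All cycle lengths are proper
divisors of `m`, without two equal to `m/2`. Exposing the cycles of three points in turn leaves at
most τ lengths each time, out of `n`, at least `m/2` and at least `m/6` equally likely ones, so the
probability is at most `12τ³/(nm²)` (`cycleExp_errorIndicator_le`). The divisor bound `τ = n^{o(1)}`
finishes the proof.

Probabilities are computed on partitions weighted by inverse centralizer orders, where exposing a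
cycle is the recursion `natCast_mul_cycleExp`. -/

namespace ExactOrder

open Finset

open scoped Nat

/-! ### Expectations over random cycle types -/

/-- The order of the centralizer of a permutation whose cycle lengths, fixed points included,
are the members of `s`. -/
def centralizerCard (s : Multiset ℕ) : ℕ :=
  s.prod * ∏ d ∈ s.toFinset, (s.count d)!

theorem centralizerCard_cons (a : ℕ) (s : Multiset ℕ) :
    centralizerCard (a ::ₘ s) = a * (s.count a + 1) * centralizerCard s := by
  have h : ∏ d ∈ (a ::ₘ s).toFinset, ((a ::ₘ s).count d)!
      = (s.count a + 1) * ∏ d ∈ s.toFinset, (s.count d)! := by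
    have h1 : ∏ d ∈ s.toFinset, (s.count d)! = ∏ d ∈ (a ::ₘ s).toFinset, (s.count d)! := by
      refine Finset.prod_subset (by simp [Multiset.toFinset_cons]) fun d _ hd => ?_
      rw [Multiset.count_eq_zero_of_notMem (by simpa using hd), Nat.factorial_zero]
    have ha : a ∈ (a ::ₘ s).toFinset := by simp
    rw [h1, ← Finset.mul_prod_erase _ _ ha, ← Finset.mul_prod_erase _ _ ha,
      Multiset.count_cons_self, Nat.factorial_succ, mul_assoc]
    congr 2
    refine Finset.prod_congr rfl fun d hd => ?_
    rw [Multiset.count_cons_of_ne (Finset.ne_of_mem_erase hd)]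
  rw [centralizerCard, h, Multiset.prod_cons, centralizerCard]
  ring

theorem centralizerCard_add_replicate_one (s : Multiset ℕ) (hs : 1 ∉ s) (j : ℕ) :
    centralizerCard (s + Multiset.replicate j 1) = j ! * centralizerCard s := by
  induction j with
  | zero => simp
  | succ j ih =>
    rw [Multiset.replicate_succ, Multiset.add_cons, centralizerCard_cons, ih,
      Multiset.count_add, Multiset.count_eq_zero_of_notMem hs, Multiset.count_replicate_self,
      Nat.factorial_succ]
    ring

theorem centralizerCard_pos {n : ℕ} (p : n.Partition) : 0 < centralizerCard p.parts :=
  Nat.mul_pos (Nat.pos_of_ne_zero <| Multiset.prod_ne_zero fun h => (p.parts_pos h).ne' rfl)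
    (Finset.prod_pos fun _ _ => Nat.factorial_pos _)

/-- The expectation of `F` at the multiset of cycle lengths of a uniformly random permutation
of `n` letters. -/
noncomputable def cycleExp (n : ℕ) (F : Multiset ℕ → ℝ) : ℝ :=
  ∑ p : n.Partition, F p.parts / centralizerCard p.parts

theorem cycleExp_congr {n : ℕ} {F G : Multiset ℕ → ℝ}
    (h : ∀ p : n.Partition, F p.parts = G p.parts) : cycleExp n F = cycleExp n G :=
  Finset.sum_congr rfl fun p _ => by rw [h p]

theorem cycleExp_mono {n : ℕ} {F G : Multiset ℕ → ℝ}
    (h : ∀ p : n.Partition, F p.parts ≤ G p.parts) : cycleExp n F ≤ cycleExp n G :=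
  Finset.sum_le_sum fun p _ => by gcongr; exact h p

theorem cycleExp_const_mul (n : ℕ) (c : ℝ) (F : Multiset ℕ → ℝ) :
    cycleExp n (fun s => c * F s) = c * cycleExp n F := by
  simp only [cycleExp, mul_div_assoc, Finset.mul_sum]

theorem cycleExp_zero (n : ℕ) : cycleExp n (fun _ => 0) = 0 := by
  simp [cycleExp]

/-- Adjoining a part to a partition. -/
def consPartition {k : ℕ} (d : ℕ) (hd : 0 < d) (p : k.Partition) : (d + k).Partition where
  parts := d ::ₘ p.parts
  parts_pos := by
    intro i hi
    rcases Multiset.mem_cons.1 hi with rfl | h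
    · exact hd
    · exact p.parts_pos h
  parts_sum := by rw [Multiset.sum_cons, p.parts_sum]

/-- Adjoining a part `d` multiplies the centralizer order by `d` times the new multiplicity of `d`,
which cancels the factor `s.count d`. -/
theorem cycleExp_count_mul {d : ℕ} (hd : 0 < d) (k : ℕ) (G : Multiset ℕ → ℝ) :
    cycleExp (d + k) (fun s => s.count d * G (s.erase d)) = 1 / d * cycleExp k G := by
  rw [cycleExp, cycleExp, Finset.mul_sum]
  symm
  refine Finset.sum_of_injOn (consPartition d hd) ?_ (fun _ _ => Finset.mem_coe.2 (Finset.mem_univ _)) ?_ ?_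
  · intro p _ q _ h
    have := congrArg Nat.Partition.parts h
    exact Nat.Partition.ext ((Multiset.cons_inj_right d).1 this)
  · intro p _ hp
    have : d ∉ p.parts := by
      intro hmem
      refine hp ⟨⟨p.parts.erase d, fun h => p.parts_pos (Multiset.mem_of_mem_erase h), ?_⟩, by simp, ?_⟩
      · have h1 := p.parts_sum
        rw [← Multiset.cons_erase hmem, Multiset.sum_cons] at h1
        omega
      · exact Nat.Partition.ext (Multiset.cons_erase hmem)
    rw [Multiset.count_eq_zero_of_notMem this]
    simp
  · intro p _
    have hz : (centralizerCard p.parts : ℝ) ≠ 0 := by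
      exact_mod_cast (centralizerCard_pos p).ne'
    have hd' : (d : ℝ) ≠ 0 := by exact_mod_cast hd.ne'
    have hc : ((p.parts.count d : ℝ) + 1) ≠ 0 := by positivity
    simp only [consPartition, Multiset.count_cons_self, Multiset.erase_cons_head,
      centralizerCard_cons]
    push_cast
    field_simp

/-- The cycle through a given point has uniformly distributed length. In terms of weights: expand
`n` as the sum of `d * count d` and remove one part `d` from each term. -/
theorem natCast_mul_cycleExp (n : ℕ) (F : Multiset ℕ → ℝ) :
    n * cycleExp n F = ∑ d ∈ Icc 1 n, cycleExp (n - d) (fun s => F (d ::ₘ s)) := by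
  have h1 : ∀ d ∈ Icc 1 n, cycleExp (n - d) (fun s => F (d ::ₘ s))
      = cycleExp n (fun s => d * (s.count d * F s)) := by
    intro d hd
    obtain ⟨hd1, hdn⟩ := Finset.mem_Icc.1 hd
    obtain ⟨k, rfl⟩ := Nat.exists_eq_add_of_le hdn
    have h2 : cycleExp (d + k) (fun s => s.count d * F s)
        = 1 / d * cycleExp k (fun s => F (d ::ₘ s)) := by
      rw [← cycleExp_count_mul hd1]
      refine cycleExp_congr fun p => ?_
      by_cases hmem : d ∈ p.parts
      · rw [Multiset.cons_erase hmem]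
      · simp [Multiset.count_eq_zero_of_notMem hmem]
    rw [cycleExp_const_mul, h2, Nat.add_sub_cancel_left]
    have : (d : ℝ) ≠ 0 := by exact_mod_cast (show d ≠ 0 by omega)
    field_simp
  rw [Finset.sum_congr rfl h1, ← cycleExp_const_mul]
  simp only [cycleExp]
  rw [Finset.sum_comm]
  refine Finset.sum_congr rfl fun p _ => ?_
  rw [← Finset.sum_div]
  congr 1
  have h3 : (n : ℝ) = ∑ d ∈ Icc 1 n, (d : ℝ) * p.parts.count d := by
    have h4 : p.parts.sum = ∑ d ∈ Icc 1 n, p.parts.count d * d := by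
      rw [Finset.sum_multiset_count]
      refine Finset.sum_subset (fun d hd => ?_) fun d _ hd => ?_
      · have hd' := Multiset.mem_toFinset.1 hd
        exact Finset.mem_Icc.2 ⟨p.parts_pos hd', p.le_of_mem_parts hd'⟩
      · rw [Multiset.count_eq_zero_of_notMem (by simpa using hd), zero_smul]
    rw [p.parts_sum] at h4
    conv_lhs => rw [h4]
    push_cast
    exact Finset.sum_congr rfl fun d _ => mul_comm _ _
  conv_lhs => rw [h3]
  rw [Finset.sum_mul]
  exact Finset.sum_congr rfl fun d _ => by ring

theorem cycleExp_one (n : ℕ) : cycleExp n (fun _ => 1) = 1 := by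
  induction n using Nat.strong_induction_on with
  | _ n ih =>
    rcases Nat.eq_zero_or_pos n with rfl | hn
    · have h0 : (default : Nat.Partition 0).parts = 0 :=
        Multiset.eq_zero_of_forall_notMem fun a ha =>
          (Nat.Partition.parts_pos _ ha).ne' (Nat.le_zero.1 (Nat.Partition.le_of_mem_parts ha))
      rw [cycleExp, Fintype.sum_unique, h0]
      simp [centralizerCard]
    · have h := natCast_mul_cycleExp n (fun _ => 1)
      rw [Finset.sum_congr rfl (g := fun _ => (1 : ℝ)) fun d hd => ih (n - d) (by
        have := Finset.mem_Icc.1 hd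
        omega)] at h
      have hn' : (n : ℝ) ≠ 0 := by exact_mod_cast hn.ne'
      simpa [hn'] using h

/-- The union bound for exposing one cycle: in the recursion only the lengths in `D` contribute. -/
theorem cycleExp_le_of_cons_le {n : ℕ} {F : Multiset ℕ → ℝ} {D : Finset ℕ} {c : ℝ}
    (hn : 0 < n) (hD : ∀ s, F s ≠ 0 → ∀ d ∈ s, d ∈ D) (hc : 0 ≤ c)
    (h : ∀ d ∈ D, d ≤ n → cycleExp (n - d) (fun s => F (d ::ₘ s)) ≤ c) :
    cycleExp n F ≤ #D * c / n := by
  have hn' : (0 : ℝ) < n := by exact_mod_cast hn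
  rw [le_div_iff₀' hn', natCast_mul_cycleExp]
  calc ∑ d ∈ Icc 1 n, cycleExp (n - d) (fun s => F (d ::ₘ s))
      ≤ ∑ d ∈ Icc 1 n, if d ∈ D then c else 0 := by
        refine Finset.sum_le_sum fun d hd => ?_
        split_ifs with hdD
        · exact h d hdD (Finset.mem_Icc.1 hd).2
        · have h0 : ∀ s, F (d ::ₘ s) = 0 := by
            intro s
            by_contra hs
            exact hdD (hD _ hs d (Multiset.mem_cons_self _ _))
          simp only [h0, cycleExp_zero, le_refl]
    _ ≤ ∑ d ∈ D, c := by
        rw [← Finset.sum_filter]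
        exact Finset.sum_le_sum_of_subset_of_nonneg
          (fun d hd => (Finset.mem_filter.1 hd).2) fun _ _ _ => hc
    _ = #D * c := by rw [Finset.sum_const, nsmul_eq_mul]

/-! ### From permutations to partitions -/

section Permutations

variable {α : Type*} [Fintype α] [DecidableEq α]

theorem card_partition_eq_mul (p : (Fintype.card α).Partition) :
    #{σ : Equiv.Perm α | σ.partition = p} * centralizerCard p.parts = (Fintype.card α)! := by
  set m := p.parts.filter (2 ≤ ·) with hm
  -- `cycleType` omits fixed points, so the parts equal to 1 are split off.
  have hparts : p.parts = m + Multiset.replicate (Fintype.card α - m.sum) 1 := by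
    have h1 : p.parts.filter (fun d => ¬ 2 ≤ d)
        = Multiset.replicate (Multiset.card (p.parts.filter (fun d => ¬ 2 ≤ d))) 1 := by
      refine Multiset.eq_replicate.2 ⟨rfl, fun d hd => ?_⟩
      have h2 := Multiset.mem_filter.1 hd
      have := p.parts_pos h2.1
      omega
    have h3 := Multiset.filter_add_not (2 ≤ ·) p.parts
    rw [h1, ← hm] at h3
    have h4 := congrArg Multiset.sum h3
    rw [p.parts_sum, Multiset.sum_add, Multiset.sum_replicate, smul_eq_mul, mul_one] at h4
    rw [← Nat.eq_sub_of_add_eq' h4, h3]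
  have hset : Finset.univ.filter (fun σ : Equiv.Perm α => σ.partition = p)
      = Finset.univ.filter fun σ : Equiv.Perm α => σ.cycleType = m := by
    ext σ
    simp only [Finset.mem_filter, Finset.mem_univ, true_and]
    constructor
    · rintro rfl
      exact Equiv.Perm.filter_parts_partition_eq_cycleType.symm
    · intro h
      rw [Nat.Partition.ext_iff, Equiv.Perm.parts_partition, ← Equiv.Perm.sum_cycleType, h, ← hparts]
  have h1 : 1 ∉ m := fun h => by simpa using (Multiset.mem_filter.1 h).2
  have hle : m.sum ≤ Fintype.card α := by
    have h2 := congrArg Multiset.sum hparts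
    rw [p.parts_sum, Multiset.sum_add] at h2
    omega
  have key := Equiv.Perm.card_of_cycleType_mul_eq α m
  rw [if_pos ⟨hle, fun a ha => (Multiset.mem_filter.1 ha).2⟩] at key
  rw [hset, hparts, centralizerCard_add_replicate_one _ h1, centralizerCard, ← key]
  ring

theorem lcm_parts_partition (σ : Equiv.Perm α) : σ.partition.parts.lcm = orderOf σ := by
  rw [Equiv.Perm.parts_partition, Multiset.lcm_add, Equiv.Perm.lcm_cycleType]
  have h : (Multiset.replicate (Fintype.card α - #σ.support) 1).lcm ∣ 1 :=
    Multiset.lcm_dvd.2 fun b hb => (Multiset.eq_of_mem_replicate hb).dvd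
  rw [Nat.dvd_one.1 h]
  simp

theorem card_orderOf_div_card (m : ℕ) :
    (Nat.card {σ : Equiv.Perm α // orderOf σ = m} : ℝ) / (Nat.card (Equiv.Perm α) : ℝ)
      = cycleExp (Fintype.card α) (fun s => if s.lcm = m then 1 else 0) := by
  have h1 : Nat.card {σ : Equiv.Perm α // orderOf σ = m}
      = ∑ p : (Fintype.card α).Partition,
          if p.parts.lcm = m then #{σ : Equiv.Perm α | σ.partition = p} else 0 := by
    rw [Nat.card_eq_fintype_card, Fintype.card_subtype,
      Finset.card_eq_sum_card_fiberwise (f := Equiv.Perm.partition) (t := Finset.univ)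
        fun _ _ => by simp]
    refine Finset.sum_congr rfl fun p _ => ?_
    rw [Finset.filter_filter]
    split_ifs with hp
    · congr 1
      ext σ
      simp only [Finset.mem_filter, Finset.mem_univ, true_and, and_iff_right_iff_imp]
      rintro rfl
      rw [← hp, lcm_parts_partition]
    · rw [Finset.card_eq_zero, Finset.filter_eq_empty_iff]
      rintro σ - ⟨h, rfl⟩
      exact hp (by rw [lcm_parts_partition, h])
  rw [h1, Nat.card_perm, Nat.card_eq_fintype_card, cycleExp]
  push_cast
  rw [Finset.sum_div]
  refine Finset.sum_congr rfl fun p _ => ?_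
  have hz : (centralizerCard p.parts : ℝ) ≠ 0 := by exact_mod_cast (centralizerCard_pos p).ne'
  have hf : ((Fintype.card α)! : ℝ) ≠ 0 := by exact_mod_cast (Nat.factorial_pos _).ne'
  split_ifs with hp
  · rw [div_eq_div_iff hf hz, one_mul]
    exact_mod_cast card_partition_eq_mul p
  · simp

end Permutations

theorem orderProb_eq_cycleExp (n m : ℕ) :
    orderProb n m = cycleExp n (fun s => if s.lcm = m then 1 else 0) := by
  rw [orderProb, card_orderOf_div_card, Fintype.card_fin]

/-! ### The divisor bound -/

/-- Compare `a + 1` with `p^(aδ)` prime by prime. Once `p ≥ 2^(1/δ)` there is no loss, since `a + 1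
≤ 2^a`; each of the fewer than `P` smaller primes costs at most a factor `M`. -/
theorem exists_card_divisors_le_mul_rpow {δ : ℝ} (hδ : 0 < δ) :
    ∃ C : ℝ, 1 ≤ C ∧ ∀ n : ℕ, n ≠ 0 → (#n.divisors : ℝ) ≤ C * (n : ℝ) ^ δ := by
  have hl : 0 < Real.log 2 := Real.log_pos one_lt_two
  set M : ℝ := max 1 (1 / (δ * Real.log 2)) with hM
  have hM1 : 1 ≤ M := le_max_left _ _
  set P : ℕ := ⌈(2 : ℝ) ^ (1 / δ)⌉₊ with hP
  refine ⟨M ^ P, one_le_pow₀ hM1, fun n hn => ?_⟩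
  have hsmall : ∀ a : ℕ, (a : ℝ) + 1 ≤ M * ((2 : ℝ) ^ a) ^ δ := by
    intro a
    have h1 : ((2 : ℝ) ^ a) ^ δ = Real.exp (a * (δ * Real.log 2)) := by
      rw [← Real.rpow_natCast, ← Real.rpow_mul two_pos.le, Real.rpow_def_of_pos two_pos]
      ring_nf
    have h2 := Real.add_one_le_exp (a * (δ * Real.log 2))
    have h3 : 1 ≤ M * (δ * Real.log 2) := by
      rw [← div_le_iff₀ (by positivity)]
      exact le_max_right _ _
    rw [h1]
    calc (a : ℝ) + 1 ≤ M * (δ * Real.log 2) * a + M := by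
          nlinarith [mul_le_mul_of_nonneg_right h3 (Nat.cast_nonneg (α := ℝ) a)]
      _ = M * (a * (δ * Real.log 2) + 1) := by ring
      _ ≤ _ := by gcongr
  have hfac : ∀ p ∈ n.primeFactors, ((n.factorization p + 1 : ℕ) : ℝ)
      ≤ (if p < P then M else 1) * (((p : ℝ) ^ n.factorization p) ^ δ) := by
    intro p hp
    have hp2 : (2 : ℝ) ≤ p := by exact_mod_cast (Nat.prime_of_mem_primeFactors hp).two_le
    push_cast
    split_ifs with hpP
    · refine (hsmall _).trans ?_
      gcongr
    · have h2p : (2 : ℝ) ≤ (p : ℝ) ^ δ := by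
        have h1 : (2 : ℝ) ^ (1 / δ) ≤ p := (Nat.le_ceil _).trans (by exact_mod_cast not_lt.1 hpP)
        calc (2 : ℝ) = ((2 : ℝ) ^ (1 / δ)) ^ δ := by
              rw [← Real.rpow_mul two_pos.le, one_div_mul_cancel hδ.ne', Real.rpow_one]
          _ ≤ _ := by gcongr
      have h3 : ((p : ℝ) ^ n.factorization p) ^ δ = ((p : ℝ) ^ δ) ^ n.factorization p := by
        rw [← Real.rpow_natCast, ← Real.rpow_mul (by positivity), mul_comm,
          Real.rpow_mul (by positivity), Real.rpow_natCast]
      rw [one_mul, h3]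
      calc ((n.factorization p : ℝ) + 1) ≤ (2 : ℝ) ^ n.factorization p := by
            exact_mod_cast Nat.lt_two_pow_self (n := n.factorization p)
        _ ≤ _ := by gcongr
  have hprod : (n : ℝ) ^ δ = ∏ p ∈ n.primeFactors, ((p : ℝ) ^ n.factorization p) ^ δ := by
    rw [Real.finsetProd_rpow _ _ fun _ _ => by positivity]
    congr 1
    exact_mod_cast (Nat.prod_factorization_pow_eq_self hn).symm
  rw [Nat.card_divisors hn, Nat.cast_prod, hprod]
  refine (Finset.prod_le_prod (fun _ _ => by positivity) hfac).trans ?_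
  rw [Finset.prod_mul_distrib]
  gcongr
  rw [← Finset.prod_filter, Finset.prod_const]
  refine pow_le_pow_right₀ hM1 ?_
  calc #{p ∈ n.primeFactors | p < P} ≤ #(range P) :=
        Finset.card_le_card fun p hp => Finset.mem_range.2 (Finset.mem_filter.1 hp).2
    _ = P := Finset.card_range P

open Filter in
theorem exists_tendsto_zero_card_divisors_pow_le (r : ℕ) :
    ∃ ε : ℕ → ℝ, Tendsto ε atTop (nhds 0) ∧ (∀ n, 0 ≤ ε n) ∧
      ∀ n m : ℕ, m ≠ 0 → m ≤ n → (#m.divisors : ℝ) ^ r ≤ (n : ℝ) ^ ε n := by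
  -- `ε n` is defined by `n ^ ε n = T n` for `n ≥ 2`; the maximum with 1 makes it nonnegative.
  set T : ℕ → ℕ := fun n => (range (n + 1)).sup fun m => max 1 (#m.divisors ^ r) with hT
  have hT1 : ∀ n, 1 ≤ T n := fun n =>
    (le_max_left 1 _).trans
      (Finset.le_sup (f := fun m : ℕ => max 1 (#m.divisors ^ r)) (Finset.mem_range.2 n.succ_pos))
  have hT1' : ∀ n, (1 : ℝ) ≤ T n := fun n => by exact_mod_cast hT1 n
  have hTle : ∀ n m : ℕ, m ≤ n → #m.divisors ^ r ≤ T n := fun n m hm =>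
    (le_max_right 1 _).trans
      (Finset.le_sup (f := fun m : ℕ => max 1 (#m.divisors ^ r)) (Finset.mem_range.2 (by omega)))
  have hε0 : ∀ n : ℕ, 0 ≤ Real.log (T n) / Real.log n := fun n =>
    div_nonneg (Real.log_nonneg (hT1' n)) (Real.log_natCast_nonneg n)
  refine ⟨fun n => Real.log (T n) / Real.log n, ?_, hε0, ?_⟩
  · rw [Metric.tendsto_atTop']
    intro e he
    -- The `r`-th power then has exponent at most `e / 2`; the other `e / 2` absorbs `C ^ r`.
    obtain ⟨C, hC1, hC⟩ := exists_card_divisors_le_mul_rpow (δ := e / (2 * (r + 1))) (by positivity)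
    have hbound : ∀ n : ℕ, 1 ≤ n → (T n : ℝ) ≤ C ^ r * (n : ℝ) ^ (e / 2) := by
      intro n hn
      have hn' : (1 : ℝ) ≤ n := by exact_mod_cast hn
      have hone : 1 ≤ C ^ r * (n : ℝ) ^ (e / 2) :=
        one_le_mul_of_one_le_of_one_le (one_le_pow₀ hC1)
          (Real.one_le_rpow hn' (by positivity))
      obtain ⟨m, hm, hmT⟩ := Finset.exists_mem_eq_sup (range (n + 1)) ⟨0, by simp⟩
        (fun m => max 1 (#m.divisors ^ r))
      have hTm : T n = max 1 (#m.divisors ^ r) := hmT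
      rw [hTm, Nat.cast_max, Nat.cast_one]
      refine max_le hone ?_
      rcases Nat.eq_zero_or_pos m with rfl | hmpos
      · push_cast
        refine le_trans ?_ hone
        simpa using pow_le_one₀ (le_refl (0 : ℝ)) zero_le_one
      · have hmn : (m : ℝ) ≤ n := by exact_mod_cast Nat.lt_succ_iff.1 (Finset.mem_range.1 hm)
        push_cast
        calc (#m.divisors : ℝ) ^ r ≤ (C * (n : ℝ) ^ (e / (2 * (r + 1)))) ^ r := by
              refine pow_le_pow_left₀ (by positivity) ((hC m hmpos.ne').trans ?_) r
              gcongr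
          _ = C ^ r * (n : ℝ) ^ (e / (2 * (r + 1)) * r) := by
              rw [mul_pow, Real.rpow_mul (by positivity), Real.rpow_natCast]
          _ ≤ C ^ r * (n : ℝ) ^ (e / 2) := by
              gcongr
              rw [div_mul_eq_mul_div, div_le_div_iff₀ (by positivity) (by positivity)]
              nlinarith
    have hlog : Tendsto (fun n : ℕ => Real.log n) atTop atTop :=
      Real.tendsto_log_atTop.comp tendsto_natCast_atTop_atTop
    obtain ⟨N, hN⟩ := eventually_atTop.1
      (hlog.eventually_gt_atTop (max 0 (Real.log (C ^ r) / (e / 2))))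
    refine ⟨max N 1, fun n hn => ?_⟩
    have hnN : N ≤ n := (le_max_left _ _).trans hn.le
    have hn1 : 1 ≤ n := (le_max_right _ _).trans hn.le
    have hn0 : (0 : ℝ) < n := by exact_mod_cast hn1
    have hgt := hN n hnN
    have hlogpos : 0 < Real.log n := (le_max_left _ _).trans_lt hgt
    have hC' : Real.log (C ^ r) < Real.log n * (e / 2) := by
      rw [← div_lt_iff₀ (by positivity)]
      exact (le_max_right _ _).trans_lt hgt
    rw [Real.dist_eq, sub_zero, abs_of_nonneg (hε0 n), div_lt_iff₀ hlogpos]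
    have h1 := Real.log_le_log (by linarith [hT1' n]) (hbound n hn1)
    rw [Real.log_mul (by positivity) (by positivity), Real.log_rpow hn0] at h1
    linarith
  · intro n m hm0 hmn
    rcases Nat.lt_or_ge n 2 with hn | hn
    · obtain rfl : m = 1 := by omega
      obtain rfl : n = 1 := by omega
      simp
    · have hn' : (1 : ℝ) < n := by exact_mod_cast hn
      have h1 : (n : ℝ) ^ (Real.log (T n) / Real.log n) = T n := by
        rw [Real.rpow_def_of_pos (by linarith), mul_div_cancel₀ _ (Real.log_pos hn').ne',
          Real.exp_log (by linarith [hT1' n])]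
      simp only [h1]
      exact_mod_cast hTle n m hmn

/-! ### Divisibility by the numbers up to `k` -/

theorem dvd_of_mem_K {n k : ℕ} (hk : k ∈ K n) : ∀ j ∈ Icc 1 k, j ∣ n - k := fun _ hj =>
  (Finset.dvd_lcm (f := id) hj).trans (Finset.mem_filter.1 hk).2

theorem lt_of_mem_K {n k : ℕ} (hk : k ∈ K n) : k < n :=
  Finset.mem_range.1 (Finset.mem_filter.1 hk).1

/-- The coprime numbers `k` and `k - 1` both divide `n - k`, hence so does their product. The bound
on `n` is sharp: it fails for `n = 9`, `k = 3`. -/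
theorem two_mul_lt_of_mem_K {n k : ℕ} (hn : 10 ≤ n) (hk : k ∈ K n) : 2 * k < n - k := by
  have hkn := lt_of_mem_K hk
  rcases Nat.lt_or_ge k 4 with h4 | h4
  · omega
  · obtain ⟨l, rfl⟩ : ∃ l, k = l + 1 := ⟨k - 1, by omega⟩
    have h1 := dvd_of_mem_K hk (l + 1) (by simp)
    have h2 := dvd_of_mem_K hk l (Finset.mem_Icc.2 ⟨by omega, by omega⟩)
    have hcop : Nat.Coprime (l + 1) l := by simp
    have h3 := Nat.le_of_dvd (by omega) (hcop.mul_dvd_of_dvd_of_dvd h1 h2)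
    nlinarith

/-- Only the power of 2 in `j` can obstruct. It is at most `2 ^ a`, with equality only for `j = 2 ^
a`. -/
theorem dvd_of_two_pow_mul_odd {a j h : ℕ} (hj : j ∣ 2 * h) (hj0 : 0 < j)
    (hlt : j < 2 ^ (a + 1)) (ha : 2 ^ a ∣ h ∨ 0 < a ∧ 2 ^ a ∣ 2 * h ∧ j ≠ 2 ^ a) : j ∣ h := by
  obtain ⟨b, o, ho, rfl⟩ := Nat.exists_eq_two_pow_mul_odd hj0.ne'
  have ho2 : Nat.Coprime o 2 := ho.coprime_two_right
  have hoh : o ∣ h := ho2.dvd_of_dvd_mul_left ((dvd_mul_left o _).trans hj)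
  refine (Nat.Coprime.pow_left b ho2.symm).mul_dvd_of_dvd_of_dvd ?_ hoh
  have hb : b < a + 1 := (Nat.pow_lt_pow_iff_right one_lt_two).1
    ((Nat.le_mul_of_pos_right _ ho.pos).trans_lt hlt)
  rcases ha with ha | ⟨ha0, ha, hne⟩
  · exact (pow_dvd_pow 2 (Nat.lt_succ_iff.1 hb)).trans ha
  · have hba : b ≠ a := by
      rintro rfl
      have : o < 2 := by
        rw [pow_succ] at hlt
        exact lt_of_mul_lt_mul_left hlt (Nat.zero_le _)
      have := ho.pos
      obtain rfl : o = 1 := by omega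
      exact hne (mul_one _)
    obtain ⟨c, rfl⟩ : ∃ c, a = c + 1 := ⟨a - 1, by omega⟩
    rw [pow_succ, mul_comm (2 ^ c)] at ha
    exact (pow_dvd_pow 2 (by omega)).trans (Nat.dvd_of_mul_dvd_mul_left two_pos ha)

/-- If `2^(a+1) ∤ 2h`, the only part not dividing `h` is `2^a`. As `2 * 2^a > k`, it occurs at most
once, so its probability equals its expected multiplicity `1/2^a`. -/
theorem cycleExp_lcm_eq_two_mul {k h : ℕ} (hh : 0 < h) (hdvd : ∀ j ∈ Icc 1 k, j ∣ 2 * h) :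
    cycleExp k (fun s => if Nat.lcm h s.lcm = 2 * h then 1 else 0)
      = if 2 ^ (Nat.log 2 k + 1) ∣ 2 * h then 0 else 1 / 2 ^ Nat.log 2 k := by
  set a := Nat.log 2 k with ha
  have hlt : k < 2 ^ (a + 1) := Nat.lt_pow_succ_log_self one_lt_two k
  have hmem : ∀ p : k.Partition, ∀ j ∈ p.parts, 0 < j ∧ j < 2 ^ (a + 1) ∧ j ∣ 2 * h := by
    intro p j hj
    have h1 := p.parts_pos hj
    have h2 := p.le_of_mem_parts hj
    exact ⟨h1, h2.trans_lt hlt, hdvd j (Finset.mem_Icc.2 ⟨h1, h2⟩)⟩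
  have hne : ∀ s : Multiset ℕ, (∀ j ∈ s, j ∣ h) → ¬ Nat.lcm h s.lcm = 2 * h := by
    intro s hs h1
    rw [Nat.lcm_eq_left (Multiset.lcm_dvd.2 hs)] at h1
    omega
  split_ifs with hpow
  · refine (cycleExp_congr (G := fun _ => 0) fun p => if_neg (hne _ fun j hj => ?_)).trans
      (cycleExp_zero k)
    obtain ⟨h0, h1, h2⟩ := hmem p j hj
    refine dvd_of_two_pow_mul_odd h2 h0 h1 (Or.inl ?_)
    rw [pow_succ, mul_comm] at hpow
    exact Nat.dvd_of_mul_dvd_mul_left two_pos hpow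
  · have hk2 : 2 ≤ k := by
      by_contra hk
      have : a = 0 := Nat.log_of_lt (by omega)
      simp [this] at hpow
    have ha0 : 0 < a := Nat.log_pos one_lt_two hk2
    have hak : 2 ^ a ≤ k := Nat.pow_log_le_self 2 (by omega)
    have ha2 : 2 ^ a ∣ 2 * h := hdvd _ (Finset.mem_Icc.2 ⟨Nat.one_le_two_pow, hak⟩)
    have hah : ¬ 2 ^ a ∣ h := fun h1 => hpow (by
      rw [pow_succ, mul_comm]
      exact Nat.mul_dvd_mul_left 2 h1)
    obtain ⟨l, hl⟩ := Nat.exists_eq_add_of_le hak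
    have hcount : cycleExp k (fun s => s.count (2 ^ a)) = 1 / 2 ^ a := by
      have := cycleExp_count_mul (d := 2 ^ a) (by positivity) l (fun _ => 1)
      rw [cycleExp_one, ← hl] at this
      simpa using this
    rw [← hcount]
    refine cycleExp_congr fun p => ?_
    by_cases hap : 2 ^ a ∈ p.parts
    · have h1 : p.parts.count (2 ^ a) = 1 := by
        refine le_antisymm ?_ (Multiset.one_le_count_iff_mem.2 hap)
        by_contra h2
        have h3 : Multiset.replicate 2 (2 ^ a) ≤ p.parts :=
          Multiset.le_count_iff_replicate_le.1 (by omega)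
        obtain ⟨t, ht⟩ := Multiset.le_iff_exists_add.1 h3
        have h4 := congrArg Multiset.sum ht
        rw [p.parts_sum, Multiset.sum_add, Multiset.sum_replicate, smul_eq_mul] at h4
        rw [pow_succ] at hlt
        omega
      have h5 : Nat.lcm h p.parts.lcm = 2 * h := by
        have hle : Nat.lcm h p.parts.lcm ∣ 2 * h :=
          Nat.lcm_dvd (dvd_mul_left _ _) (Multiset.lcm_dvd.2 fun j hj => (hmem p j hj).2.2)
        obtain ⟨t, ht⟩ := Nat.dvd_lcm_left h p.parts.lcm
        rw [ht, mul_comm 2] at hle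
        have ht2 := (Nat.dvd_prime Nat.prime_two).1 (Nat.dvd_of_mul_dvd_mul_left hh hle)
        rcases ht2 with rfl | rfl
        · refine absurd ?_ hah
          rw [mul_one] at ht
          rw [← ht]
          exact (Multiset.dvd_lcm hap).trans (Nat.dvd_lcm_right _ _)
        · rw [ht, mul_comm]
      rw [if_pos h5, h1, Nat.cast_one]
    · rw [Multiset.count_eq_zero_of_notMem hap, Nat.cast_zero]
      refine if_neg (hne _ fun j hj => ?_)
      obtain ⟨h0, h1, h2⟩ := hmem p j hj
      exact dvd_of_two_pow_mul_odd h2 h0 h1 (Or.inr ⟨ha0, ha2, fun h => hap (h ▸ hj)⟩)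

/-! ### Main terms and error term -/

open Classical in
/-- The indicator of the event that all cycle lengths are proper divisors of `m` and that there are
no two cycles of length `m / 2`. -/
noncomputable def errorIndicator (m : ℕ) (s : Multiset ℕ) : ℝ :=
  if (∀ d ∈ s, d ∈ m.properDivisors) ∧ ∀ d, 2 * d = m → s.count d < 2 then 1 else 0

theorem errorIndicator_nonneg (m : ℕ) (s : Multiset ℕ) : 0 ≤ errorIndicator m s := by
  unfold errorIndicator
  split_ifs <;> norm_num

theorem errorIndicator_le_one (m : ℕ) (s : Multiset ℕ) : errorIndicator m s ≤ 1 := by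
  unfold errorIndicator
  split_ifs <;> norm_num

theorem of_errorIndicator_ne_zero {m : ℕ} {s : Multiset ℕ} (h : errorIndicator m s ≠ 0) :
    (∀ d ∈ s, d ∈ m.properDivisors) ∧ ∀ d, 2 * d = m → s.count d < 2 := by
  unfold errorIndicator at h
  by_contra hs
  exact h (if_neg hs)

theorem two_mul_le_of_mem_properDivisors {m d : ℕ} (h : d ∈ m.properDivisors) : 2 * d ≤ m := by
  obtain ⟨⟨q, rfl⟩, hlt⟩ := Nat.mem_properDivisors.1 h
  have : 2 ≤ q := by
    by_contra hq
    have : q = 0 ∨ q = 1 := by omega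
    rcases this with rfl | rfl <;> simp at hlt
  nlinarith

theorem three_mul_le_of_mem_properDivisors {m d : ℕ} (h : d ∈ m.properDivisors)
    (h2 : 2 * d ≠ m) : 3 * d ≤ m := by
  obtain ⟨⟨q, rfl⟩, hlt⟩ := Nat.mem_properDivisors.1 h
  have : 3 ≤ q := by
    by_contra hq
    have : q = 0 ∨ q = 1 ∨ q = 2 := by omega
    rcases this with rfl | rfl | rfl
    · simp at hlt
    · simp at hlt
    · exact h2 (mul_comm _ _)
  nlinarith

theorem cycleExp_errorIndicator_le {m k : ℕ} (hm : 0 < m) :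
    cycleExp (m + k) (errorIndicator m) ≤ 12 * (#m.divisors : ℝ) ^ 3 / ((m + k) * m ^ 2) := by
  set τ : ℝ := (#m.divisors : ℝ) with hτ
  have hm0 : (0 : ℝ) < m := by exact_mod_cast hm
  have hcard : (#m.properDivisors : ℝ) ≤ τ := by
    rw [hτ]
    exact_mod_cast Finset.card_le_card Nat.properDivisors_subset_divisors
  have hτ0 : 0 ≤ τ := by positivity
  have h1 : cycleExp (m + k) (errorIndicator m)
      ≤ #m.properDivisors * (12 * τ ^ 2 / m ^ 2) / (m + k : ℕ) := by
    refine cycleExp_le_of_cons_le (by omega) (fun s hs => (of_errorIndicator_ne_zero hs).1)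
      (by positivity) fun d₁ hd₁ _ => ?_
    have hd₁2 := two_mul_le_of_mem_properDivisors hd₁
    have hN₁ : (m : ℝ) / 2 ≤ (m + k - d₁ : ℕ) := by
      rw [div_le_iff₀ two_pos]
      exact_mod_cast (show m ≤ (m + k - d₁) * 2 by omega)
    have h2 : cycleExp (m + k - d₁) (fun s => errorIndicator m (d₁ ::ₘ s))
        ≤ #m.properDivisors * (6 * τ / m) / (m + k - d₁ : ℕ) := by
      refine cycleExp_le_of_cons_le (by omega)
        (fun s hs d hd => (of_errorIndicator_ne_zero hs).1 d (Multiset.mem_cons_of_mem hd))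
        (by positivity) fun d₂ hd₂ _ => ?_
      by_cases hhalf : d₁ = d₂ ∧ 2 * d₁ = m
      · obtain ⟨rfl, hd⟩ := hhalf
        have h0 : ∀ s, errorIndicator m (d₁ ::ₘ d₁ ::ₘ s) = 0 := by
          intro s
          by_contra hs
          have := (of_errorIndicator_ne_zero hs).2 d₁ hd
          simp only [Multiset.count_cons_self] at this
          omega
        simp only [h0, cycleExp_zero]
        positivity
      have hd₂2 := two_mul_le_of_mem_properDivisors hd₂
      -- Two proper divisors, not both `m/2`, add up to at most `m/2 + m/3`.
      have hsum : 6 * (d₁ + d₂) ≤ 5 * m := by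
        by_cases hd : 2 * d₁ = m
        · have := three_mul_le_of_mem_properDivisors hd₂ (fun h => hhalf ⟨by omega, hd⟩)
          omega
        · have := three_mul_le_of_mem_properDivisors hd₁ hd
          omega
      have hN₂ : (m : ℝ) / 6 ≤ (m + k - d₁ - d₂ : ℕ) := by
        rw [div_le_iff₀ (by norm_num)]
        exact_mod_cast (show m ≤ (m + k - d₁ - d₂) * 6 by omega)
      have h3 : cycleExp (m + k - d₁ - d₂) (fun s => errorIndicator m (d₁ ::ₘ d₂ ::ₘ s))
          ≤ #m.properDivisors * 1 / (m + k - d₁ - d₂ : ℕ) := by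
        refine cycleExp_le_of_cons_le (by omega)
          (fun s hs d hd => (of_errorIndicator_ne_zero hs).1 d
            (Multiset.mem_cons_of_mem (Multiset.mem_cons_of_mem hd)))
          zero_le_one fun d₃ _ _ => ?_
        rw [← cycleExp_one (m + k - d₁ - d₂ - d₃)]
        exact cycleExp_mono fun p => errorIndicator_le_one _ _
      refine h3.trans ?_
      calc (#m.properDivisors : ℝ) * 1 / (m + k - d₁ - d₂ : ℕ) ≤ τ * 1 / (m / 6) := by gcongr
        _ = 6 * τ / m := by field_simp
    refine h2.trans ?_
    calc (#m.properDivisors : ℝ) * (6 * τ / m) / (m + k - d₁ : ℕ)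
        ≤ τ * (6 * τ / m) / (m / 2) := by gcongr
      _ = 12 * τ ^ 2 / m ^ 2 := by field_simp; ring
  refine h1.trans ?_
  push_cast
  calc (#m.properDivisors : ℝ) * (12 * τ ^ 2 / m ^ 2) / (m + k)
      ≤ τ * (12 * τ ^ 2 / m ^ 2) / (m + k) := by gcongr
    _ = 12 * τ ^ 3 / ((m + k) * m ^ 2) := by field_simp

theorem indicator_lcm_le_errorIndicator {m : ℕ} (hm : 0 < m) {s : Multiset ℕ} (hs : m ∉ s)
    (h2 : ∀ d, 2 * d = m → s.count d < 2) :
    (if s.lcm = m then (1 : ℝ) else 0) ≤ errorIndicator m s := by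
  split_ifs with h
  · refine le_of_eq (if_pos ⟨fun d hd => ?_, h2⟩).symm
    have hdm : d ∣ m := h ▸ Multiset.dvd_lcm hd
    refine Nat.mem_properDivisors.2 ⟨hdm, lt_of_le_of_ne (Nat.le_of_dvd hm hdm) ?_⟩
    rintro rfl
    exact hs hd
  · exact errorIndicator_nonneg _ _

theorem count_eq_zero_of_sum_lt {d : ℕ} {s : Multiset ℕ} (h : s.sum < d) : s.count d = 0 :=
  Multiset.count_eq_zero_of_notMem fun hd => h.not_ge (Multiset.le_sum_of_mem hd)

/-- The contribution to the event that the order is `m` of a pair of cycles of length `m / 2`,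
as a function of the cycle lengths. -/
noncomputable def halfPairTerm (m : ℕ) (s : Multiset ℕ) : ℝ :=
  if Even m then
    1 / 2 * (s.count (m / 2) * ((s.erase (m / 2)).count (m / 2) *
      if Nat.lcm (m / 2) ((s.erase (m / 2)).erase (m / 2)).lcm = m then 1 else 0))
  else 0

/-- An `m`-cycle and a pair of `m/2`-cycles exclude each other, and in either case the difference
vanishes. Otherwise both subtracted terms are zero. -/
theorem abs_indicator_lcm_sub_le {m k : ℕ} (hkm : 2 * k < m) (hdvd : ∀ j ∈ Icc 1 k, j ∣ m)
    (p : (m + k).Partition) :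
    |(if p.parts.lcm = m then (1 : ℝ) else 0) - p.parts.count m - halfPairTerm m p.parts|
      ≤ errorIndicator m p.parts := by
  have hpos : ∀ j ∈ p.parts, 0 < j := fun j hj => p.parts_pos hj
  have hsum := p.parts_sum
  generalize p.parts = s at hpos hsum
  have hhalf0 : s.count (m / 2) < 2 → halfPairTerm m s = 0 := by
    intro h1
    have : (s.count (m / 2) : ℝ) * ((s.erase (m / 2)).count (m / 2) : ℝ) = 0 := by
      rw [Multiset.count_erase_self, mul_eq_zero]
      norm_cast
      omega
    rw [halfPairTerm, ← mul_assoc (s.count (m / 2) : ℝ), this]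
    simp
  by_cases hmem : m ∈ s
  · obtain ⟨t, rfl⟩ := Multiset.exists_cons_of_mem hmem
    rw [Multiset.sum_cons] at hsum
    have ht : t.sum = k := by omega
    have hlcm : (m ::ₘ t).lcm = m := by
      rw [Multiset.lcm_cons]
      refine Nat.lcm_eq_left (Multiset.lcm_dvd.2 fun j hj => hdvd j (Finset.mem_Icc.2 ⟨?_, ?_⟩))
      · exact hpos j (Multiset.mem_cons_of_mem hj)
      · exact ht ▸ Multiset.le_sum_of_mem hj
    have hc : (m ::ₘ t).count m = 1 := by
      rw [Multiset.count_cons_self, count_eq_zero_of_sum_lt (by omega)]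
    have hh : (m ::ₘ t).count (m / 2) < 2 := by
      rw [Multiset.count_cons_of_ne (by omega)]
      by_contra h2
      -- Positivity is needed when `m = 1`, where `m / 2 = 0`.
      have h3 := hpos _ (Multiset.mem_cons_of_mem
        (Multiset.count_pos.1 (show 0 < t.count (m / 2) by omega)))
      have h4 : Multiset.replicate 2 (m / 2) ≤ t :=
        Multiset.le_count_iff_replicate_le.1 (by omega)
      obtain ⟨u, hu⟩ := Multiset.le_iff_exists_add.1 h4
      have h5 := congrArg Multiset.sum hu
      rw [Multiset.sum_add, Multiset.sum_replicate, smul_eq_mul] at h5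
      omega
    rw [if_pos hlcm, hc, hhalf0 hh]
    simpa using errorIndicator_nonneg _ _
  have hc : s.count m = 0 := Multiset.count_eq_zero_of_notMem hmem
  rw [hc, Nat.cast_zero, sub_zero]
  by_cases hpair : Even m ∧ 2 ≤ s.count (m / 2)
  · obtain ⟨heven, h2⟩ := hpair
    obtain ⟨h, hh⟩ := heven
    have hmh : m / 2 = h := by omega
    rw [hmh] at h2
    obtain ⟨t, rfl⟩ := Multiset.exists_cons_of_mem (Multiset.count_pos.1 (show 0 < s.count h by omega))
    rw [Multiset.count_cons_self] at h2
    obtain ⟨u, rfl⟩ := Multiset.exists_cons_of_mem (Multiset.count_pos.1 (show 0 < t.count h by omega))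
    rw [Multiset.sum_cons, Multiset.sum_cons] at hsum
    have hcu : u.count h = 0 := count_eq_zero_of_sum_lt (by omega)
    have hlcm : (h ::ₘ h ::ₘ u).lcm = Nat.lcm h u.lcm := by
      rw [Multiset.lcm_cons, Multiset.lcm_cons]
      change Nat.lcm h (Nat.lcm h u.lcm) = _
      rw [← Nat.lcm_assoc, Nat.lcm_self]
    have hterm : halfPairTerm m (h ::ₘ h ::ₘ u) = if Nat.lcm h u.lcm = m then 1 else 0 := by
      rw [halfPairTerm, if_pos ⟨h, hh⟩, hmh, Multiset.erase_cons_head, Multiset.erase_cons_head,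
        Multiset.count_cons_self, Multiset.count_cons_self, hcu]
      push_cast
      ring
    rw [hterm, hlcm, sub_self, abs_zero]
    exact errorIndicator_nonneg _ _
  · have hterm : halfPairTerm m s = 0 := by
      by_cases heven : Even m
      · exact hhalf0 (by
          by_contra h2
          exact hpair ⟨heven, by omega⟩)
      · rw [halfPairTerm, if_neg heven]
    rw [hterm, sub_zero, abs_of_nonneg (by split_ifs <;> norm_num)]
    refine indicator_lcm_le_errorIndicator (by omega) hmem fun d hd => ?_
    by_contra h2
    refine hpair ⟨⟨d, by omega⟩, ?_⟩
    rw [show m / 2 = d by omega]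
    omega

/-- Removing the two half-length cycles one at a time gives `1/2 * (1/h) * (1/h)` times the 2-adic
probability. -/
theorem cycleExp_halfPairTerm {m k : ℕ} (hm : 0 < m) (hdvd : ∀ j ∈ Icc 1 k, j ∣ m) :
    cycleExp (m + k) (halfPairTerm m) = eta (m + k) k := by
  have hcast : ((m + k : ℕ) : ℝ) - k = m := by push_cast; ring
  rw [eta, Nat.add_sub_cancel, hcast]
  by_cases heven : Even m
  · obtain ⟨h, rfl⟩ := heven
    have hh : 0 < h := by omega
    have hh' : (h : ℝ) ≠ 0 := by exact_mod_cast hh.ne'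
    have hhalf : (h + h) / 2 = h := by omega
    unfold halfPairTerm
    simp only [if_pos (Even.add_self h), hhalf]
    rw [cycleExp_const_mul, add_assoc,
      cycleExp_count_mul hh (h + k) (fun t => t.count h *
        if Nat.lcm h (t.erase h).lcm = h + h then 1 else 0),
      cycleExp_count_mul hh k (fun u => if Nat.lcm h u.lcm = h + h then 1 else 0)]
    rw [← two_mul] at hdvd ⊢
    rw [cycleExp_lcm_eq_two_mul hh hdvd]
    -- For `k ≤ 1` the logarithm is 0, and the divisibility reads `2 ∣ 2 * h`.
    have hiff : ((k = 0 ∨ k = 1) ∨ 2 ^ (Nat.log 2 k + 1) ∣ 2 * h)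
        ↔ 2 ^ (Nat.log 2 k + 1) ∣ 2 * h := by
      refine or_iff_right_of_imp ?_
      rintro (rfl | rfl) <;> simp
    simp only [hiff]
    split_ifs
    · simp
    · rw [zpow_sub₀ two_ne_zero]
      push_cast
      rw [zpow_one, zpow_natCast]
      field_simp
  · have hk : k = 0 ∨ k = 1 := by
      by_contra hk
      exact heven (even_iff_two_dvd.2 (hdvd 2 (Finset.mem_Icc.2 ⟨one_le_two, by omega⟩)))
    rw [if_pos (Or.inl hk), ← cycleExp_zero (m + k)]
    exact cycleExp_congr fun p => if_neg heven

theorem abs_orderProb_sub_le {n k : ℕ} (hn : 10 ≤ n) (hk : k ∈ K n) :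
    |orderProb n (n - k) - (1 / ((n : ℝ) - k) + eta n k)|
      ≤ 12 * (#(n - k).divisors : ℝ) ^ 3 / (n * ((n : ℝ) - k) ^ 2) := by
  have hkn := lt_of_mem_K hk
  have h2k := two_mul_lt_of_mem_K hn hk
  have hdvd := dvd_of_mem_K hk
  obtain ⟨m, rfl⟩ : ∃ m, n = m + k := ⟨n - k, by omega⟩
  rw [Nat.add_sub_cancel] at h2k hdvd ⊢
  have hm : 0 < m := by omega
  have hcast : ((m + k : ℕ) : ℝ) - k = m := by push_cast; ring
  have hcount : cycleExp (m + k) (fun s => (s.count m : ℝ)) = 1 / m := by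
    simpa [cycleExp_one] using cycleExp_count_mul hm k (fun _ => 1)
  have hmain : orderProb (m + k) m - (1 / (m : ℝ) + eta (m + k) k)
      = cycleExp (m + k) (fun s =>
          (if s.lcm = m then (1 : ℝ) else 0) - s.count m - halfPairTerm m s) := by
    rw [orderProb_eq_cycleExp, ← hcount, ← cycleExp_halfPairTerm hm hdvd]
    simp only [cycleExp, sub_div, Finset.sum_sub_distrib]
    ring
  rw [hcast, hmain]
  calc |cycleExp (m + k) (fun s =>
          (if s.lcm = m then (1 : ℝ) else 0) - s.count m - halfPairTerm m s)|
      ≤ cycleExp (m + k) (errorIndicator m) := by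
        refine (Finset.abs_sum_le_sum_abs _ _).trans (Finset.sum_le_sum fun p _ => ?_)
        rw [abs_div, Nat.abs_cast]
        gcongr
        exact abs_indicator_lcm_sub_le h2k hdvd p
    _ ≤ _ := cycleExp_errorIndicator_le hm
    _ = _ := by push_cast; ring

/-! ### Crude bounds for small `n`, and conclusion -/

theorem orderProb_le_one (n m : ℕ) : orderProb n m ≤ 1 := by
  rw [orderProb_eq_cycleExp]
  refine (cycleExp_mono (G := fun _ => 1) fun p => ?_).trans_eq (cycleExp_one n)
  split_ifs <;> norm_num

theorem orderProb_nonneg (n m : ℕ) : 0 ≤ orderProb n m := by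
  unfold orderProb
  positivity

theorem eta_nonneg (n k : ℕ) : 0 ≤ eta n k := by
  unfold eta
  split_ifs
  · exact le_rfl
  · positivity

theorem eta_le_two {n k : ℕ} (hk : k < n) : eta n k ≤ 2 := by
  unfold eta
  split_ifs
  · norm_num
  · have h1 : (1 : ℝ) ≤ (n : ℝ) - k := by
      have : (k : ℝ) + 1 ≤ n := by exact_mod_cast hk
      linarith
    refine (div_le_self (by positivity) (one_le_pow₀ h1)).trans ?_
    calc (2 : ℝ) ^ (1 - (Nat.log 2 k : ℤ)) ≤ 2 ^ (1 : ℤ) :=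
          zpow_le_zpow_right₀ one_le_two (by omega)
      _ = 2 := zpow_one 2

theorem abs_orderProb_sub_le_three {n k : ℕ} (hk : k < n) :
    |orderProb n (n - k) - (1 / ((n : ℝ) - k) + eta n k)| ≤ 3 := by
  have h1 : (1 : ℝ) ≤ (n : ℝ) - k := by
    have : (k : ℝ) + 1 ≤ n := by exact_mod_cast hk
    linarith
  have h2 : 1 / ((n : ℝ) - k) ≤ 1 := (div_le_one (by linarith)).2 h1
  have h3 : 0 ≤ 1 / ((n : ℝ) - k) := by positivity
  rw [abs_le]
  constructor <;>
    linarith [orderProb_le_one n (n - k), orderProb_nonneg n (n - k), eta_le_two hk, eta_nonneg n k]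

end ExactOrder

open ExactOrder Finset in
theorem proposition4p1 :
    ∃ (C : ℝ) (ε : ℕ → ℝ), 0 < C ∧ Filter.Tendsto ε Filter.atTop (nhds 0) ∧
      ∀ n : ℕ, 1 ≤ n → ∀ k ∈ ExactOrder.K n,
        |ExactOrder.orderProb n (n - k)
            - (1 / ((n : ℝ) - (k : ℝ)) + ExactOrder.eta n k)|
          ≤ C * (n : ℝ) ^ (-3 + ε n) := by
  obtain ⟨ε, hε, hε0, hdiv⟩ := exists_tendsto_zero_card_divisors_pow_le 3
  -- The range `n ≤ 9` needs `3 * 9 ^ 3 = 2187`; for `n ≥ 10`, `12 * 2 ^ 2 = 48` suffices.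
  refine ⟨3000, ε, by norm_num, hε, fun n hn k hk => ?_⟩
  have hkn := lt_of_mem_K hk
  have hn1 : (1 : ℝ) ≤ n := by exact_mod_cast hn
  have hpow : (n : ℝ) ^ (-3 + ε n) = (n : ℝ) ^ ε n / n ^ 3 := by
    rw [Real.rpow_add (by linarith), Real.rpow_neg (by linarith)]
    norm_cast
    ring
  rw [hpow]
  have hone : 1 ≤ (n : ℝ) ^ ε n := Real.one_le_rpow hn1 (hε0 n)
  rcases Nat.lt_or_ge n 10 with h10 | h10
  · refine (abs_orderProb_sub_le_three hkn).trans ?_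
    have h9 : (n : ℝ) ≤ 9 := by exact_mod_cast Nat.lt_succ_iff.1 h10
    have h3 : (n : ℝ) ^ 3 ≤ 9 ^ 3 := by gcongr
    rw [mul_div_assoc', le_div_iff₀ (by positivity)]
    nlinarith
  · refine (abs_orderProb_sub_le h10 hk).trans ?_
    have h2k := two_mul_lt_of_mem_K h10 hk
    have hmn : (n : ℝ) / 2 ≤ (n : ℝ) - k := by
      have : (3 * k : ℝ) < n := by exact_mod_cast (show 3 * k < n by omega)
      have hk0 : (0 : ℝ) ≤ k := Nat.cast_nonneg k
      linarith
    calc 12 * (#(n - k).divisors : ℝ) ^ 3 / (n * ((n : ℝ) - k) ^ 2)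
        ≤ 12 * (n : ℝ) ^ ε n / (n * ((n : ℝ) / 2) ^ 2) := by
          gcongr
          exact hdiv n (n - k) (by omega) (Nat.sub_le _ _)
      _ = 48 * ((n : ℝ) ^ ε n / n ^ 3) := by
          field_simp
          ring
      _ ≤ 3000 * ((n : ℝ) ^ ε n / n ^ 3) := by
          gcongr
          norm_num
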